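/- Write $d\mu_2(x)=\frac{dx}{2\pi}$ on $\mathbb{R}^2$ and $d\mu_4(\xi,b)=\frac{d\xi\,db}{(2\pi)^2}$ on $\mathbb{R}^2\times\mathbb{R}^2=\mathbb{R}^4$, let $\mathbb{H}$ be the real quaternions with units $i,j,k$, and for $g\in L^1(\mathbb{R}^2,\mathbb{H})$ let $$\mathcal{F}_Q(g)(u,v)=\int_{\mathbb{R}^2}e^{-ixu}\,g(x,y)\,e^{-jyv}\,d\mu_2(x,y)$$ be its two-sided quaternion Fourier transform. For $\xi=(\xi_1,\xi_2)\in\mathbb{R}^2$ put $A_\xi=\operatorname{diag}(\xi_1,\xi_2)$. Let $\varphi$ be an admissible quaternion window, that is, a nonzero function $\varphi\in L^1(\mathbb{R}^2,\mathbb{H})\cap L^2(\mathbb{R}^2,\mathbb{H})$ such that $$C_\varphi=\int_{\mathbb{R}^2}\big|\mathcal{F}_Q(\overline{\varphi})(1-\xi_1,1-\xi_2)\big|^2\,\frac{d\mu_2(\xi)}{|\det A_\xi|}$$ is finite and positive. Assume moreover that, for all $u,v,y\in\mathbb{R}$, $$\mathcal{F}_Q(\varphi)(u,v)\,e^{-jvy}=e^{-jvy}\,\mathcal{F}_Q(\varphi)(u,v)\quad\text{and}\quad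 \mathcal{F}_Q(j\varphi)(u,v)\,e^{-jvy}=j\,e^{-jvy}\,\mathcal{F}_Q(\varphi)(u,v).$$ For $f\in L^2(\mathbb{R}^2,\mathbb{H})$, let $$(S_\varphi^Q f)(\xi,b)=|\det A_\xi|^{1/2}\int_{\mathbb{R}^2}e^{-ix_1\xi_1}\,f(x)\,e^{-jx_2\xi_2}\,\overline{\varphi(A_\xi(x-b))}\,d\mu_2(x),\qquad \xi,b\in\mathbb{R}^2,$$ be the continuous quaternion Stockwell transform of $f$. Theorem (Donoho–Stark for $S_\varphi^Q$). Let $f\in L^2(\mathbb{R}^2,\mathbb{H})$ with $f\neq 0$, let $\Sigma\subset\mathbb{R}^2\times\mathbb{R}^2$ be a measurable set, and let $\alpha\ge 0$. If $S_\varphi^Q f$ is $\alpha$-concentrated on $\Sigma$, that is, $$\Big(\int_{\Sigma^c}|S_\varphi^Qf|^2\,d\mu_4\Big)^{1/2}\le\alpha\,\Big(\int_{\mathbb{R}^4}|S_\varphi^Qf|^2\,d\mu_4\Big)^{1/2},$$ then $$\mu_4(\Sigma)\ \ge\ \frac{(1-\alpha^2)\,C_\varphi}{\|\varphi\|_2^2},\qquad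 \|\varphi\|_2^2=\int_{\mathbb{R}^2}|\varphi|^2\,d\mu_2 .$$ -/

import Mathlib

open MeasureTheory
open scoped Quaternion ENNReal

noncomputable section

namespace QStockwell

/-- The quaternion unit `i`. -/
def qi : ℍ[ℝ] := ⟨0, 1, 0, 0⟩

/-- The quaternion unit `j`. -/
def qj : ℍ[ℝ] := ⟨0, 0, 1, 0⟩

/-- The exponential `e^{i t}`. -/
def expI (t : ℝ) : ℍ[ℝ] := NormedSpace.exp (t • qi)

/-- The exponential `e^{j t}`. -/
def expJ (t : ℝ) : ℍ[ℝ] := NormedSpace.exp (t • qj)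

/-- The normalized Lebesgue measure `(2π)^{-1} dx` on `ℝ²`. -/
def mu2 : Measure (ℝ × ℝ) := ENNReal.ofReal ((2 * Real.pi)⁻¹) • volume

/-- The normalized Lebesgue measure `(2π)^{-2} dξ db` on `ℝ⁴ = ℝ² × ℝ²`. -/
def mu4 : Measure ((ℝ × ℝ) × (ℝ × ℝ)) := ENNReal.ofReal (((2 * Real.pi) ^ 2)⁻¹) • volume

/-- The two-sided quaternion Fourier transform of an integrable function,
`F_Q(f)(u,v) = ∫ e^{-i x u} f(x,y) e^{-j y v} dμ₂(x,y)`. -/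
def qFourier (f : ℝ × ℝ → ℍ[ℝ]) (w : ℝ × ℝ) : ℍ[ℝ] :=
  ∫ x, expI (-(x.1 * w.1)) * f x * expJ (-(x.2 * w.2)) ∂mu2

/-- The determinant of the diagonal matrix `A_ξ = diag(ξ₁, ξ₂)`. -/
def detA (ξ : ℝ × ℝ) : ℝ := ξ.1 * ξ.2

/-- The action `x ↦ A_ξ x` of the diagonal matrix `A_ξ = diag(ξ₁, ξ₂)`. -/
def mulA (ξ x : ℝ × ℝ) : ℝ × ℝ := (ξ.1 * x.1, ξ.2 * x.2)

/-- The integrand `|F_Q(conj φ)((1,1) - ξ)|² / |det A_ξ|` of the admissibility constant. -/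
def admIntegrand (φ : ℝ × ℝ → ℍ[ℝ]) (ξ : ℝ × ℝ) : ℝ :=
  ‖qFourier (fun x => star (φ x)) ((1, 1) - ξ)‖ ^ 2 / |detA ξ|

/-- The admissibility constant `C_φ`. -/
def admConst (φ : ℝ × ℝ → ℍ[ℝ]) : ℝ := ∫ ξ, admIntegrand φ ξ ∂mu2

/-- `φ` is an admissible quaternion window: a nonzero function in `L¹ ∩ L²` for which the integral
defining `C_φ` is finite and positive. -/
structure IsAdmissible (φ : ℝ × ℝ → ℍ[ℝ]) : Prop where
  memLp_one : MemLp φ 1 mu2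
  memLp_two : MemLp φ 2 mu2
  ne_zero : ¬ φ =ᵐ[mu2] 0
  integrable : Integrable (admIntegrand φ) mu2
  pos : 0 < admConst φ

/-- The hypothesis of the convolution theorem for the quaternion Fourier transform:
`F_Q(g)(u,v) e^{-j v y} = e^{-j v y} F_Q(g)(u,v)` and
`F_Q(j g)(u,v) e^{-j v y} = j e^{-j v y} F_Q(g)(u,v)` for all real `u, v, y`. -/
structure ConvCondition (g : ℝ × ℝ → ℍ[ℝ]) : Prop where
  comm : ∀ u v y : ℝ,
    qFourier g (u, v) * expJ (-(v * y)) = expJ (-(v * y)) * qFourier g (u, v)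
  mul_j : ∀ u v y : ℝ,
    qFourier (fun x => qj * g x) (u, v) * expJ (-(v * y)) =
      qj * expJ (-(v * y)) * qFourier g (u, v)

/-- The continuous quaternion Stockwell transform, as a function of `p = (ξ, b)`:
`|det A_ξ|^{1/2} ∫ e^{-i x₁ ξ₁} f(x) e^{-j x₂ ξ₂} conj(φ(A_ξ (x - b))) dμ₂(x)`. -/
def stockwell (φ f : ℝ × ℝ → ℍ[ℝ]) (p : (ℝ × ℝ) × (ℝ × ℝ)) : ℍ[ℝ] :=
  Real.sqrt |detA p.1| •
    ∫ x, expI (-(x.1 * p.1.1)) * f x * expJ (-(x.2 * p.1.2)) * star (φ (mulA p.1 (x - p.2))) ∂mu2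

/-- `F` is `α`-concentrated on `E`: `(∫_{Eᶜ} |F|² dμ₄)^{1/2} ≤ α ‖F‖₂`, with norms in `[0, ∞]`. -/
def IsConcentrated (F : (ℝ × ℝ) × (ℝ × ℝ) → ℍ[ℝ]) (α : ℝ) (E : Set ((ℝ × ℝ) × (ℝ × ℝ))) : Prop :=
  eLpNorm F 2 (mu4.restrict Eᶜ) ≤ ENNReal.ofReal α * eLpNorm F 2 mu4

end QStockwell

end

namespace QStockwell

open FourierTransform Complex

/-! Two facts carry the theorem: the Plancherel formula ∫|S|² dμ₄ = C_φ‖f‖² (`lintegral_stockwell`)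
and the pointwise bound |S| ≤ ‖f‖‖φ‖, which is Cauchy–Schwarz (`enorm_stockwell_sq_le`). Splitting
the energy over Σ and its complement gives C_φ‖f‖² ≤ μ₄(Σ)‖f‖²‖φ‖² + α²C_φ‖f‖², and ‖f‖² > 0
cancels.

For Plancherel, write q = (1+k)/2·a₊ + (1-k)/2·a₋ with a₊, a₋ in ℝ + ℝj ≅ ℂ. Right multiplication by
ℝ + ℝj acts ℂ-linearly on both coordinates, and left multiplication by e^{it} becomes e^{-it} on a₊
and e^{it} on a₋. So F_Q is a pair of ordinary plane Fourier transforms, one with its first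
frequency reversed. The two window conditions force φ to be (ℝ + ℝj)-valued with a transform even in
the first variable (`ConvCondition.exists_complex_window`), and S then splits into two complex
transforms, modulated at (±ξ₁, ξ₂).

For each of these, b ↦ S(ξ, b) is up to a phase a Fourier transform. Plancherel in b, Tonelli, and
the invariance of dξ/|det A_ξ| under ξ ↦ c/ξ make the energy factor into ‖f‖² times the
admissibility integral (`lintegral_energy_stockAtom`). -/

/-! ### Fourier analysis of L¹ ∩ L² on the plane -/

/-- The Fourier transform of a function in `L¹ ∩ L²`, given by the integral, agrees with its
`L²`-Fourier transform. -/
theorem fourier_toLp_ae_eq {V : Type*} [NormedAddCommGroup V] [InnerProductSpace ℝ V]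
    [FiniteDimensional ℝ V] [MeasurableSpace V] [BorelSpace V] {g : V → ℂ}
    (h1 : Integrable g) (h2 : MemLp g 2) :
    (𝓕 (h2.toLp g) : Lp ℂ 2 (volume : Measure V)) =ᵐ[volume] 𝓕 g := by
  have hcont : Continuous (𝓕 g) :=
    VectorFourier.fourierIntegral_continuous Real.continuous_fourierChar
      (by exact continuous_inner) h1
  have hloc : LocallyIntegrable (𝓕 (h2.toLp g) : Lp ℂ 2 (volume : Measure V)) volume :=
    (Lp.memLp _).locallyIntegrable (by norm_num)
  refine ae_eq_of_integral_contDiff_smul_eq hloc hcont.locallyIntegrable ?_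
  intro s hs hsc
  have hs' : ContDiff ℝ ((⊤ : ℕ∞) : WithTop ℕ∞) (fun x => (s x : ℂ)) :=
    Complex.ofRealCLM.contDiff.comp hs
  have hsc' : HasCompactSupport (fun x => (s x : ℂ)) := hsc.comp_left (g := fun r : ℝ => (r : ℂ)) rfl
  set S : SchwartzMap V ℂ := hsc'.toSchwartzMap hs' with hS
  have hSapp : ∀ x, S x = (s x : ℂ) := fun x => rfl
  -- Both sides are tested against a smooth compactly supported function: the L² transform moves
  -- onto it by duality of tempered distributions, the integral transform by Fubini.
  have key := congrArg (fun T => T S) (Lp.fourier_toTemperedDistribution_eq (h2.toLp g))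
  simp only [TemperedDistribution.fourier_apply, Lp.toTemperedDistribution_apply] at key
  have e1 : ∫ x, (𝓕 S) x • (h2.toLp g) x = ∫ x, (𝓕 S) x • g x := by
    refine integral_congr_ae ?_
    filter_upwards [h2.coeFn_toLp] with x hx
    rw [hx]
  have e2 : ∫ x, (𝓕 (S : V → ℂ)) x • g x = ∫ x, S x • 𝓕 g x := by
    have := VectorFourier.integral_fourierIntegral_smul_eq_flip (μ := (volume : Measure V))
      (ν := (volume : Measure V)) (L := innerₗ V) (f := (S : V → ℂ)) (g := g)
      Real.continuous_fourierChar (by exact continuous_inner) S.integrable h1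
    rwa [flip_innerₗ] at this
  rw [e1, SchwartzMap.fourier_coe, e2] at key
  simp only [hSapp] at key
  simpa using key.symm

/-- The Fourier transform on the plane, in the normalization
`∫ e^{-2πi(x₁w₁ + x₂w₂)} g(x) dx`. -/
noncomputable def planeFourier (g : ℝ × ℝ → ℂ) (w : ℝ × ℝ) : ℂ :=
  ∫ x, cexp (((-(2 * Real.pi * (x.1 * w.1 + x.2 * w.2)) : ℝ) : ℂ) * I) * g x

/-- `ℝ × ℝ` carries the sup norm, while `𝓕` requires an inner product space; the identity to `WithLp
2` preserves volume and transports results between the two. -/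
theorem measurePreserving_ofLp :
    MeasurePreserving (WithLp.ofLp : WithLp 2 (ℝ × ℝ) → ℝ × ℝ) volume volume :=
  WithLp.volume_preserving_ofLp ℝ ℝ

theorem measurePreserving_toLp :
    MeasurePreserving (WithLp.toLp 2 : ℝ × ℝ → WithLp 2 (ℝ × ℝ)) volume volume :=
  WithLp.volume_preserving_toLp ℝ ℝ

theorem measurableEmbedding_ofLp :
    MeasurableEmbedding (WithLp.ofLp : WithLp 2 (ℝ × ℝ) → ℝ × ℝ) :=
  (WithLp.homeomorphProd 2 ℝ ℝ).measurableEmbedding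

theorem measurableEmbedding_toLp :
    MeasurableEmbedding (WithLp.toLp 2 : ℝ × ℝ → WithLp 2 (ℝ × ℝ)) :=
  (WithLp.homeomorphProd 2 ℝ ℝ).symm.measurableEmbedding

theorem planeFourier_eq (g : ℝ × ℝ → ℂ) (w : ℝ × ℝ) :
    planeFourier g w = 𝓕 (fun v : WithLp 2 (ℝ × ℝ) => g v.ofLp) (WithLp.toLp 2 w) := by
  rw [Real.fourier_eq', planeFourier,
    ← measurePreserving_ofLp.integral_comp measurableEmbedding_ofLp]
  refine integral_congr_ae (.of_forall fun v => ?_)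
  simp only [WithLp.prod_inner_apply, smul_eq_mul]
  congr 3
  simp [mul_comm]

theorem memLp_comp_ofLp {g : ℝ × ℝ → ℂ} {p : ℝ≥0∞} (h : MemLp g p) :
    MemLp (fun v : WithLp 2 (ℝ × ℝ) => g v.ofLp) p :=
  h.comp_measurePreserving measurePreserving_ofLp

theorem continuous_planeFourier {g : ℝ × ℝ → ℂ} (h1 : MemLp g 1) :
    Continuous (planeFourier g) := by
  have hcont : Continuous (𝓕 (fun v : WithLp 2 (ℝ × ℝ) => g v.ofLp)) :=
    VectorFourier.fourierIntegral_continuous Real.continuous_fourierChar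
      (by exact continuous_inner) (memLp_one_iff_integrable.1 (memLp_comp_ofLp h1))
  rw [funext (planeFourier_eq g)]
  exact hcont.comp (WithLp.prod_continuous_toLp 2 ℝ ℝ)

theorem norm_planeFourier_le (g : ℝ × ℝ → ℂ) (w : ℝ × ℝ) :
    ‖planeFourier g w‖ ≤ ∫ x, ‖g x‖ := by
  refine (norm_integral_le_integral_norm _).trans_eq ?_
  simp only [norm_mul, Complex.norm_exp_ofReal_mul_I, one_mul]

theorem fourier_toLp_ae_eq_planeFourier {g : ℝ × ℝ → ℂ} (h1 : MemLp g 1) (h2 : MemLp g 2) :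
    (fun w : ℝ × ℝ => (𝓕 ((memLp_comp_ofLp h2).toLp _) : Lp ℂ 2 (volume : Measure _))
      (WithLp.toLp 2 w)) =ᵐ[volume] planeFourier g := by
  have := measurePreserving_toLp.quasiMeasurePreserving.ae
    (fourier_toLp_ae_eq (memLp_one_iff_integrable.1 (memLp_comp_ofLp h1)) (memLp_comp_ofLp h2))
  filter_upwards [this] with w hw
  rw [planeFourier_eq, hw]

/-- Plancherel's theorem on the plane, for functions in `L¹ ∩ L²`. -/
theorem eLpNorm_planeFourier {g : ℝ × ℝ → ℂ} (h1 : MemLp g 1) (h2 : MemLp g 2) :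
    eLpNorm (planeFourier g) 2 = eLpNorm g 2 := by
  rw [← eLpNorm_congr_ae (fourier_toLp_ae_eq_planeFourier h1 h2)]
  have hF := Lp.aestronglyMeasurable
    (𝓕 ((memLp_comp_ofLp h2).toLp _) : Lp ℂ 2 (volume : Measure (WithLp 2 (ℝ × ℝ))))
  refine (eLpNorm_comp_measurePreserving hF measurePreserving_toLp).trans ?_
  rw [← Lp.enorm_def, ← ofReal_norm, Lp.norm_fourier_eq, ofReal_norm, Lp.enorm_toLp]
  exact eLpNorm_comp_measurePreserving h2.1 measurePreserving_ofLp

/-- Parseval's identity on the plane, between an `L²` function and functions in `L¹ ∩ L²`. -/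
theorem exists_parseval {f : ℝ × ℝ → ℂ} (hf : MemLp f 2) :
    ∃ F : ℝ × ℝ → ℂ, StronglyMeasurable F ∧ MemLp F 2 ∧ eLpNorm F 2 = eLpNorm f 2 ∧
      ∀ k : ℝ × ℝ → ℂ, MemLp k 1 → MemLp k 2 →
        ∫ x, f x * star (k x) = ∫ w, F w * star (planeFourier k w) := by
  set G : Lp ℂ 2 (volume : Measure (WithLp 2 (ℝ × ℝ))) := 𝓕 ((memLp_comp_ofLp hf).toLp _) with hG
  have hm : StronglyMeasurable fun w : ℝ × ℝ => G (WithLp.toLp 2 w) :=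
    (Lp.stronglyMeasurable G).comp_measurable measurePreserving_toLp.measurable
  have hnorm : eLpNorm (fun w : ℝ × ℝ => G (WithLp.toLp 2 w)) 2 = eLpNorm f 2 := by
    refine (eLpNorm_comp_measurePreserving (Lp.aestronglyMeasurable G)
      measurePreserving_toLp).trans ?_
    rw [← Lp.enorm_def, ← ofReal_norm, Lp.norm_fourier_eq, ofReal_norm, Lp.enorm_toLp]
    exact eLpNorm_comp_measurePreserving hf.1 measurePreserving_ofLp
  refine ⟨_, hm, ⟨hm.aestronglyMeasurable, hnorm ▸ hf.2⟩, hnorm, fun k k1 k2 => ?_⟩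
  have key := Lp.inner_fourier_eq ((memLp_comp_ofLp k2).toLp _) ((memLp_comp_ofLp hf).toLp _)
  rw [← hG, L2.inner_def, L2.inner_def] at key
  have e1 : ∫ x, f x * star (k x) = ∫ v : WithLp 2 (ℝ × ℝ),
      inner ℂ ((memLp_comp_ofLp k2).toLp _ v) ((memLp_comp_ofLp hf).toLp _ v) := by
    rw [← measurePreserving_ofLp.integral_comp measurableEmbedding_ofLp]
    refine integral_congr_ae ?_
    filter_upwards [(memLp_comp_ofLp k2).coeFn_toLp, (memLp_comp_ofLp hf).coeFn_toLp] with v h h'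
    rw [h, h']
    rfl
  rw [e1, ← key, ← measurePreserving_toLp.integral_comp measurableEmbedding_toLp]
  refine integral_congr_ae ?_
  filter_upwards [fourier_toLp_ae_eq_planeFourier k1 k2] with w hw
  rw [← hw]
  rfl

/-- Uniqueness for the Fourier transform on `L¹ ∩ L²`. -/
theorem ae_eq_of_planeFourier_ae_eq {g h : ℝ × ℝ → ℂ} (g1 : MemLp g 1) (g2 : MemLp g 2)
    (h1 : MemLp h 1) (h2 : MemLp h 2) (heq : planeFourier g =ᵐ[volume] planeFourier h) :
    g =ᵐ[volume] h := by
  have hmul : ∀ (k : ℝ × ℝ → ℂ), MemLp k 1 → ∀ w : ℝ × ℝ, Integrable fun x : ℝ × ℝ =>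
      cexp (((-(2 * Real.pi * (x.1 * w.1 + x.2 * w.2)) : ℝ) : ℂ) * I) * k x := by
    intro k hk w
    refine (memLp_one_iff_integrable.1 hk).bdd_mul (c := 1) ?_ (.of_forall fun x => ?_)
    · exact Continuous.aestronglyMeasurable (by fun_prop)
    · rw [Complex.norm_exp_ofReal_mul_I]
  have hsub : planeFourier (g - h) =ᵐ[volume] 0 := by
    filter_upwards [heq] with w hw
    simp only [planeFourier, Pi.sub_apply, mul_sub] at hw ⊢
    rw [integral_sub (hmul g g1 w) (hmul h h1 w), hw, sub_self]
    rfl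
  have := eLpNorm_planeFourier (g1.sub h1) (g2.sub h2)
  rw [eLpNorm_congr_ae hsub, eLpNorm_zero, eq_comm,
    eLpNorm_eq_zero_iff (g2.sub h2).1 (by norm_num)] at this
  filter_upwards [this] with x hx
  exact sub_eq_zero.1 hx

theorem eLpNorm_two_sq {α E : Type*} [MeasurableSpace α] [NormedAddCommGroup E] (g : α → E)
    (μ : Measure α) : eLpNorm g 2 μ ^ 2 = ∫⁻ x, ‖g x‖ₑ ^ 2 ∂μ := by
  have := eLpNorm_nnreal_pow_eq_lintegral (f := g) (μ := μ) (p := 2) (by norm_num)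
  simpa using this

/-! ### Dilations by A_ξ and the invariant measure dξ/|det A_ξ| -/

theorem measurable_mulA : Measurable fun p : (ℝ × ℝ) × (ℝ × ℝ) => mulA p.1 p.2 := by
  unfold mulA
  fun_prop

theorem measurable_detA : Measurable detA := by
  unfold detA
  fun_prop

theorem detA_ne_zero_iff {ξ : ℝ × ℝ} : detA ξ ≠ 0 ↔ ξ.1 ≠ 0 ∧ ξ.2 ≠ 0 := by
  simp [detA]

theorem ae_ne_zero : ∀ᵐ ξ : ℝ × ℝ, ξ.1 ≠ 0 ∧ ξ.2 ≠ 0 := by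
  have h : ∀ᵐ x : ℝ, x ≠ 0 := by simp [ae_iff]
  exact (Measure.quasiMeasurePreserving_fst.ae h).and (Measure.quasiMeasurePreserving_snd.ae h)

theorem measurableEmbedding_mulA_sub {ξ : ℝ × ℝ} (hξ : detA ξ ≠ 0) (b : ℝ × ℝ) :
    MeasurableEmbedding fun x => mulA ξ (x - b) := by
  obtain ⟨h1, h2⟩ := detA_ne_zero_iff.1 hξ
  exact ((Homeomorph.subRight b).trans
    ((Homeomorph.mulLeft₀ ξ.1 h1).prodCongr (Homeomorph.mulLeft₀ ξ.2 h2))).measurableEmbedding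

theorem map_mulA_sub {ξ : ℝ × ℝ} (hξ : detA ξ ≠ 0) (b : ℝ × ℝ) :
    Measure.map (fun x => mulA ξ (x - b)) volume = ENNReal.ofReal |detA ξ|⁻¹ • volume := by
  obtain ⟨h1, h2⟩ := detA_ne_zero_iff.1 hξ
  have hm : Measure.map (mulA ξ) (volume : Measure (ℝ × ℝ)) =
      ENNReal.ofReal |detA ξ|⁻¹ • volume := by
    have := Measure.map_prod_map (volume : Measure ℝ) (volume : Measure ℝ)
      (measurable_const_mul ξ.1) (measurable_const_mul ξ.2)
    rw [Real.map_volume_mul_left h1, Real.map_volume_mul_left h2, Measure.prod_smul_left,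
      Measure.prod_smul_right, smul_smul, ← ENNReal.ofReal_mul (abs_nonneg _), ← abs_mul,
      ← mul_inv, abs_inv] at this
    exact this.symm
  have hc : (fun x => mulA ξ (x - b)) = mulA ξ ∘ fun x => x - b := rfl
  rw [hc, ← Measure.map_map (show Measurable (mulA ξ) from measurable_mulA.comp measurable_prodMk_left)
      (measurable_sub_const b),
    (measurePreserving_sub_right volume b).map_eq, hm]

theorem integral_comp_mulA_sub {E : Type*} [NormedAddCommGroup E] [NormedSpace ℝ E]
    {ξ : ℝ × ℝ} (hξ : detA ξ ≠ 0) (b : ℝ × ℝ) (h : ℝ × ℝ → E) :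
    ∫ x, h (mulA ξ (x - b)) = |detA ξ|⁻¹ • ∫ x, h x := by
  rw [← (measurableEmbedding_mulA_sub hξ b).integral_map, map_mulA_sub hξ, integral_smul_measure,
    ENNReal.toReal_ofReal (by positivity)]

theorem lintegral_comp_mulA_sub {ξ : ℝ × ℝ} (hξ : detA ξ ≠ 0) (b : ℝ × ℝ) (h : ℝ × ℝ → ℝ≥0∞) :
    ∫⁻ x, h (mulA ξ (x - b)) = ENNReal.ofReal |detA ξ|⁻¹ * ∫⁻ x, h x := by
  rw [← (measurableEmbedding_mulA_sub hξ b).lintegral_map, map_mulA_sub hξ, lintegral_smul_measure,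
    smul_eq_mul]

theorem memLp_comp_mulA_sub {E : Type*} [NormedAddCommGroup E] {p : ℝ≥0∞} {h : ℝ × ℝ → E}
    {ξ : ℝ × ℝ} (hξ : detA ξ ≠ 0) (b : ℝ × ℝ) (hh : MemLp h p) :
    MemLp (fun x => h (mulA ξ (x - b))) p := by
  refine ((measurableEmbedding_mulA_sub hξ b).memLp_map_measure_iff).1 ?_
  rw [map_mulA_sub hξ]
  exact hh.smul_measure ENNReal.ofReal_ne_top

theorem ae_comp_mulA_sub {P : ℝ × ℝ → Prop} {ξ : ℝ × ℝ} (hξ : detA ξ ≠ 0) (b : ℝ × ℝ)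
    (h : ∀ᵐ x, P x) : ∀ᵐ x, P (mulA ξ (x - b)) := by
  refine (measurableEmbedding_mulA_sub hξ b).ae_map_iff.1 ?_
  rw [map_mulA_sub hξ]
  exact Measure.ae_smul_measure h _

/-- The measure `dξ / |ξ|` on the line is invariant under `ξ ↦ c / ξ`. -/
theorem lintegral_inv_abs_comp_div {c : ℝ} (hc : c ≠ 0) (h : ℝ → ℝ≥0∞) :
    ∫⁻ x, ENNReal.ofReal |x|⁻¹ * h (c / x) = ∫⁻ x, ENNReal.ofReal |x|⁻¹ * h x := by
  have hae : ∀ᵐ x : ℝ, x ∈ ({0}ᶜ : Set ℝ) := by simp [ae_iff]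
  have himg : (fun x : ℝ => c / x) '' {0}ᶜ = {0}ᶜ := by
    ext y
    simp only [Set.mem_image, Set.mem_compl_iff, Set.mem_singleton_iff]
    constructor
    · rintro ⟨x, hx, rfl⟩
      exact div_ne_zero hc hx
    · intro hy
      exact ⟨c / y, div_ne_zero hc hy, by field_simp⟩
  have hinj : Set.InjOn (fun x : ℝ => c / x) {0}ᶜ := by
    intro x hx y hy hxy
    have hx : x ≠ 0 := hx
    have hy : y ≠ 0 := hy
    simp only at hxy
    rw [div_eq_div_iff hx hy] at hxy
    exact (mul_left_cancel₀ hc hxy).symm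
  have key := lintegral_image_eq_lintegral_abs_deriv_mul (s := {0}ᶜ) (f := fun x : ℝ => c / x)
    (f' := fun x => -c / x ^ 2) (measurableSet_singleton 0).compl
    (fun x hx => by
      have := ((hasDerivAt_inv (show x ≠ 0 from hx)).const_mul c).hasDerivWithinAt (s := {0}ᶜ)
      simp only [div_eq_mul_inv]
      convert! this using 1
      ring) hinj
    (fun x => ENNReal.ofReal |x|⁻¹ * h x)
  rw [himg, Measure.restrict_eq_self_of_ae_mem hae] at key
  rw [key]
  refine lintegral_congr_ae ?_
  filter_upwards [hae] with x hx
  have hx : x ≠ 0 := hx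
  -- The Jacobian works out as |-c/x²|·|c/x|⁻¹ = |x|⁻¹.
  rw [← mul_assoc, ← ENNReal.ofReal_mul (abs_nonneg _)]
  congr 2
  rw [← abs_inv, ← abs_inv, ← abs_mul, ← abs_neg]
  congr 1
  field_simp

/-- The measure `dξ / |det A_ξ|` on the plane is invariant under `ξ ↦ (c₁ / ξ₁, c₂ / ξ₂)`. -/
theorem lintegral_inv_detA_comp_div {c : ℝ × ℝ} (hc : detA c ≠ 0) {h : ℝ × ℝ → ℝ≥0∞}
    (hh : Measurable h) :
    ∫⁻ ξ, ENNReal.ofReal |detA ξ|⁻¹ * h (c.1 / ξ.1, c.2 / ξ.2) =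
      ∫⁻ ξ, ENNReal.ofReal |detA ξ|⁻¹ * h ξ := by
  obtain ⟨h1, h2⟩ := detA_ne_zero_iff.1 hc
  have hd : ∀ x y : ℝ, ENNReal.ofReal |detA (x, y)|⁻¹ =
      ENNReal.ofReal |x|⁻¹ * ENNReal.ofReal |y|⁻¹ := by
    intro x y
    rw [← ENNReal.ofReal_mul (by positivity), ← mul_inv, ← abs_mul, detA]
  have hm := measurable_detA
  rw [Measure.volume_eq_prod, lintegral_prod _ (by fun_prop), lintegral_prod _ (by fun_prop)]
  simp only [hd, mul_assoc]
  have e : ∀ (g : ℝ → ℝ → ℝ≥0∞) (x : ℝ), Measurable (g x) →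
      ∫⁻ y, ENNReal.ofReal |x|⁻¹ * (ENNReal.ofReal |y|⁻¹ * g x y) =
        ENNReal.ofReal |x|⁻¹ * ∫⁻ y, ENNReal.ofReal |y|⁻¹ * g x y := by
    intro g x hg
    exact lintegral_const_mul _ (by fun_prop)
  have l : ∀ x : ℝ, ∫⁻ y, ENNReal.ofReal |x|⁻¹ * (ENNReal.ofReal |y|⁻¹ * h (c.1 / x, c.2 / y)) =
      ENNReal.ofReal |x|⁻¹ * ∫⁻ y, ENNReal.ofReal |y|⁻¹ * h (c.1 / x, y) := by
    intro x
    rw [e (fun x y => h (c.1 / x, c.2 / y)) x (by fun_prop),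
      lintegral_inv_abs_comp_div h2 fun y => h (c.1 / x, y)]
  have r : ∀ x : ℝ, ∫⁻ y, ENNReal.ofReal |x|⁻¹ * (ENNReal.ofReal |y|⁻¹ * h (x, y)) =
      ENNReal.ofReal |x|⁻¹ * ∫⁻ y, ENNReal.ofReal |y|⁻¹ * h (x, y) :=
    fun x => e (fun x y => h (x, y)) x (by fun_prop)
  simp only [l, r]
  exact lintegral_inv_abs_comp_div h1 fun x => ∫⁻ y, ENNReal.ofReal |y|⁻¹ * h (x, y)

/-! ### The complex Stockwell transform and its energy -/

/-- The window `a`, dilated by `A_ξ`, translated by `b` and modulated at the frequency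
`(σ ξ₁, ξ₂)`. -/
noncomputable def stockAtom (a : ℝ × ℝ → ℂ) (σ : ℝ) (p : (ℝ × ℝ) × (ℝ × ℝ)) (x : ℝ × ℝ) : ℂ :=
  cexp (((σ * (x.1 * p.1.1) + x.2 * p.1.2 : ℝ) : ℂ) * I) * a (mulA p.1 (x - p.2))

theorem memLp_stockAtom {a : ℝ × ℝ → ℂ} {q : ℝ≥0∞} (ha : MemLp a q) (σ : ℝ) {ξ : ℝ × ℝ}
    (hξ : detA ξ ≠ 0) (b : ℝ × ℝ) : MemLp (stockAtom a σ (ξ, b)) q := by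
  have h := memLp_comp_mulA_sub hξ b ha
  refine h.congr_norm ?_ (.of_forall fun x => ?_)
  · exact (Continuous.aestronglyMeasurable (by fun_prop)).mul h.1
  · simp only [stockAtom, norm_mul, Complex.norm_exp_ofReal_mul_I, one_mul]

/-- The substitution y = A_ξ(x - b) gives the Jacobian and the two phases; modulation by (σξ₁, ξ₂),
rescaled by A_ξ, becomes the fixed shift (σ, 1)/2π. -/
theorem planeFourier_stockAtom (a : ℝ × ℝ → ℂ) (σ : ℝ) {ξ : ℝ × ℝ} (hξ : detA ξ ≠ 0)
    (b w : ℝ × ℝ) :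
    planeFourier (stockAtom a σ (ξ, b)) w = ((|detA ξ|⁻¹ : ℝ) : ℂ) *
      (cexp (((σ * (b.1 * ξ.1) + b.2 * ξ.2 : ℝ) : ℂ) * I) *
      (cexp (((-(2 * Real.pi * (b.1 * w.1 + b.2 * w.2)) : ℝ) : ℂ) * I) *
      planeFourier a (w.1 / ξ.1 - σ / (2 * Real.pi), w.2 / ξ.2 - 1 / (2 * Real.pi)))) := by
  obtain ⟨h1, h2⟩ := detA_ne_zero_iff.1 hξ
  rw [planeFourier, planeFourier, ← integral_const_mul, ← integral_const_mul, ← real_smul,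
    ← integral_comp_mulA_sub hξ b]
  refine integral_congr_ae (.of_forall fun x => ?_)
  simp only [stockAtom, mulA, ← mul_assoc, ← Complex.exp_add, ← add_mul, ← ofReal_add,
    Prod.fst_sub, Prod.snd_sub]
  congr 4
  field_simp
  ring

/-- Parseval in x exhibits the coefficient, up to a phase and |det A_ξ|⁻¹, as the Fourier transform
at -b of F times the conjugate of the shifted, dilated transform of `a`; Plancherel in b then
removes b. -/
theorem lintegral_enorm_sq_stockAtom {f a : ℝ × ℝ → ℂ} (F : ℝ × ℝ → ℂ) (hF : MemLp F 2)
    (hP : ∀ k : ℝ × ℝ → ℂ, MemLp k 1 → MemLp k 2 →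
        ∫ x, f x * star (k x) = ∫ w, F w * star (planeFourier k w))
    (a1 : MemLp a 1) (a2 : MemLp a 2) (σ : ℝ) {ξ : ℝ × ℝ} (hξ : detA ξ ≠ 0) :
    ENNReal.ofReal |detA ξ| * ∫⁻ b, ‖∫ x, f x * star (stockAtom a σ (ξ, b) x)‖ₑ ^ 2 =
      ENNReal.ofReal |detA ξ|⁻¹ * ∫⁻ w, ‖F w‖ₑ ^ 2 * ‖planeFourier a
        (w.1 / ξ.1 - σ / (2 * Real.pi), w.2 / ξ.2 - 1 / (2 * Real.pi))‖ₑ ^ 2 := by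
  obtain ⟨h1, h2⟩ := detA_ne_zero_iff.1 hξ
  set A : ℝ × ℝ → ℂ := fun w =>
    planeFourier a (w.1 / ξ.1 - σ / (2 * Real.pi), w.2 / ξ.2 - 1 / (2 * Real.pi)) with hA
  have hcont : Continuous (planeFourier a) := continuous_planeFourier a1
  have hA2 : MemLp A 2 := by
    have hinv : detA (ξ.1⁻¹, ξ.2⁻¹) ≠ 0 := by simp [detA, h1, h2]
    -- The translation is chosen so that (w₁ - σξ₁/2π)/ξ₁ = w₁/ξ₁ - σ/2π, and likewise in the second
    -- variable.
    have := memLp_comp_mulA_sub hinv (σ / (2 * Real.pi) * ξ.1, 1 / (2 * Real.pi) * ξ.2)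
      (h := planeFourier a) (p := 2)
      ⟨hcont.aestronglyMeasurable, by rw [eLpNorm_planeFourier a1 a2]; exact a2.2⟩
    refine (memLp_congr_ae (.of_forall fun w => ?_)).1 this
    simp only [hA, mulA, Prod.fst_sub, Prod.snd_sub]
    congr 2 <;> field_simp
  have hAc : Continuous A := by fun_prop
  set g : ℝ × ℝ → ℂ := fun w => F w * star (A w) with hg
  have hA2' : MemLp (fun w => star (A w)) 2 := hA2.star
  -- Plancherel needs g in L¹ ∩ L²: L¹ as a product of L² functions, L² because the transform of `a`
  -- is bounded by ‖a‖₁.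
  have g1 : MemLp g 1 := memLp_one_iff_integrable.2 (hF.integrable_mul hA2')
  have g2 : MemLp g 2 := by
    refine hF.of_le_mul (c := ∫ x, ‖a x‖) g1.1 (.of_forall fun w => ?_)
    rw [hg]
    simp only [norm_mul, norm_star]
    rw [mul_comm]
    gcongr
    exact norm_planeFourier_le a _
  have hT : ∀ b, ‖∫ x, f x * star (stockAtom a σ (ξ, b) x)‖ₑ =
      ENNReal.ofReal |detA ξ|⁻¹ * ‖planeFourier g (-b)‖ₑ := by
    intro b
    have : ∫ x, f x * star (stockAtom a σ (ξ, b) x) = ((|detA ξ|⁻¹ : ℝ) : ℂ) *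
        (cexp (((-(σ * (b.1 * ξ.1) + b.2 * ξ.2) : ℝ) : ℂ) * I) * planeFourier g (-b)) := by
      rw [hP _ (memLp_stockAtom a1 σ hξ b) (memLp_stockAtom a2 σ hξ b), planeFourier,
        ← integral_const_mul, ← integral_const_mul]
      refine integral_congr_ae (.of_forall fun w => ?_)
      simp only [planeFourier_stockAtom a σ hξ, hg, star_mul', Complex.star_def,
        ← Complex.exp_conj, map_mul, conj_ofReal, conj_I, Prod.fst_neg, Prod.snd_neg, hA]
      have e1 : ∀ r : ℝ, (r : ℂ) * -I = ((-r : ℝ) : ℂ) * I := by intro r; push_cast; ring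
      simp only [e1]
      have e2 : -(-(2 * Real.pi * (b.1 * w.1 + b.2 * w.2))) =
        -(2 * Real.pi * (w.1 * -b.1 + w.2 * -b.2)) := by ring
      rw [e2]
      ring
    rw [this, enorm_mul, enorm_mul, ← ofReal_norm (cexp _), Complex.norm_exp_ofReal_mul_I,
      ENNReal.ofReal_one, one_mul, ← ofReal_norm ((|detA ξ|⁻¹ : ℝ) : ℂ), Complex.norm_real,
      Real.norm_of_nonneg (by positivity)]
  have hpos : 0 < |detA ξ| := abs_pos.2 hξ
  simp only [hT, mul_pow]
  rw [lintegral_const_mul' _ _ (by simp), ← mul_assoc]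
  congr 1
  · rw [pow_two, ← mul_assoc, ← ENNReal.ofReal_mul hpos.le, mul_inv_cancel₀ hpos.ne',
      ENNReal.ofReal_one, one_mul]
  · rw [lintegral_neg_eq_self (fun b => ‖planeFourier g b‖ₑ ^ 2), ← eLpNorm_two_sq,
      eLpNorm_planeFourier g1 g2, eLpNorm_two_sq]
    refine lintegral_congr fun w => ?_
    rw [hg, enorm_mul, mul_pow, ← ofReal_norm (star _), norm_star, ofReal_norm]

/-- Energy identity for the complex Stockwell transform whose window has a Fourier transform that is
even in the first variable. -/
theorem lintegral_energy_stockAtom {f a : ℝ × ℝ → ℂ} (hf : MemLp f 2)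
    (a1 : MemLp a 1) (a2 : MemLp a 2)
    (heven : ∀ u v : ℝ, planeFourier a (-u, v) = planeFourier a (u, v))
    {σ : ℝ} (hσ : σ = 1 ∨ σ = -1) :
    ∫⁻ ξ, ENNReal.ofReal |detA ξ| * ∫⁻ b, ‖∫ x, f x * star (stockAtom a σ (ξ, b) x)‖ₑ ^ 2 =
      (∫⁻ x, ‖f x‖ₑ ^ 2) * ∫⁻ ξ, ENNReal.ofReal |detA ξ|⁻¹ *
        ‖planeFourier a ((ξ.1 - 1) / (2 * Real.pi), (ξ.2 - 1) / (2 * Real.pi))‖ₑ ^ 2 := by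
  obtain ⟨F, hFm, hF2, hFn, hP⟩ := exists_parseval hf
  have hFm' : Measurable fun w => ‖F w‖ₑ ^ 2 := hFm.enorm.pow_const 2
  have hcont : Continuous (planeFourier a) := continuous_planeFourier a1
  have hdet := measurable_detA
  set h : ℝ × ℝ → ℝ≥0∞ := fun ξ =>
    ‖planeFourier a ((ξ.1 - 1) / (2 * Real.pi), (ξ.2 - 1) / (2 * Real.pi))‖ₑ ^ 2 with hh
  have hhm : Measurable h := by
    have : Continuous h := by fun_prop
    exact this.measurable
  have hpi := Real.pi_ne_zero
  -- For σ = -1, evenness replaces w₁/ξ₁ + 1/2π by -w₁/ξ₁ - 1/2π, so σ survives only as a sign in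
  -- the numerator c = 2π(σw₁, w₂).
  have hcov : ∀ w ξ : ℝ × ℝ, ‖planeFourier a
        (w.1 / ξ.1 - σ / (2 * Real.pi), w.2 / ξ.2 - 1 / (2 * Real.pi))‖ₑ ^ 2 =
      h (2 * Real.pi * σ * w.1 / ξ.1, 2 * Real.pi * w.2 / ξ.2) := by
    intro w ξ
    rw [hh]
    rcases hσ with rfl | rfl
    · simp only
      congr 4 <;> field_simp
    · simp only
      rw [← heven]
      congr 4
      · field_simp; ring
      · field_simp
  calc _ = ∫⁻ ξ : ℝ × ℝ, ∫⁻ w : ℝ × ℝ, ‖F w‖ₑ ^ 2 * (ENNReal.ofReal |detA ξ|⁻¹ *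
        h (2 * Real.pi * σ * w.1 / ξ.1, 2 * Real.pi * w.2 / ξ.2)) := by
        refine lintegral_congr_ae ?_
        filter_upwards [ae_ne_zero] with ξ hξ
        rw [lintegral_enorm_sq_stockAtom F hF2 hP a1 a2 σ (detA_ne_zero_iff.2 hξ),
          ← lintegral_const_mul' _ _ ENNReal.ofReal_ne_top]
        refine lintegral_congr fun w => ?_
        rw [hcov]
        ring
    _ = ∫⁻ w : ℝ × ℝ, ∫⁻ ξ : ℝ × ℝ, ‖F w‖ₑ ^ 2 * (ENNReal.ofReal |detA ξ|⁻¹ *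
        h (2 * Real.pi * σ * w.1 / ξ.1, 2 * Real.pi * w.2 / ξ.2)) := by
        rw [lintegral_lintegral_swap]
        refine Measurable.aemeasurable ?_
        refine (hFm'.comp measurable_snd).mul (.mul (by fun_prop) (hhm.comp (by fun_prop)))
    _ = ∫⁻ w : ℝ × ℝ, ‖F w‖ₑ ^ 2 * ∫⁻ ξ : ℝ × ℝ, ENNReal.ofReal |detA ξ|⁻¹ * h ξ := by
        refine lintegral_congr_ae ?_
        filter_upwards [ae_ne_zero] with w hw
        have hm : Measurable fun ξ : ℝ × ℝ => ENNReal.ofReal |detA ξ|⁻¹ *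
            h (2 * Real.pi * σ * w.1 / ξ.1, 2 * Real.pi * w.2 / ξ.2) :=
          .mul (by fun_prop) (hhm.comp (by fun_prop))
        rw [lintegral_const_mul _ hm]
        congr 1
        have hσ0 : σ ≠ 0 := by rcases hσ with rfl | rfl <;> norm_num
        exact lintegral_inv_detA_comp_div (c := (2 * Real.pi * σ * w.1, 2 * Real.pi * w.2))
          (by simp [detA, hσ0, hw.1, hw.2]) hhm
    _ = _ := by
        rw [lintegral_mul_const _ hFm', ← eLpNorm_two_sq, hFn, eLpNorm_two_sq]

/-! ### Splitting ℍ into two complex coordinates -/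

/-- The first complex coordinate of a quaternion in the decomposition
`q = (1 + k)/2 · a₊ + (1 - k)/2 · a₋` with `a₊`, `a₋` in `ℝ + ℝj`. -/
noncomputable def posPart : ℍ[ℝ] →L[ℝ] ℂ :=
  LinearMap.toContinuousLinearMap
    { toFun := fun q => ⟨q.re + q.imK, q.imJ - q.imI⟩
      map_add' := fun p q => by apply Complex.ext <;> simp <;> ring
      map_smul' := fun r q => by apply Complex.ext <;> simp <;> ring }

/-- The second complex coordinate of a quaternion in the decomposition
`q = (1 + k)/2 · a₊ + (1 - k)/2 · a₋` with `a₊`, `a₋` in `ℝ + ℝj`. -/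
noncomputable def negPart : ℍ[ℝ] →L[ℝ] ℂ :=
  LinearMap.toContinuousLinearMap
    { toFun := fun q => ⟨q.re - q.imK, q.imJ + q.imI⟩
      map_add' := fun p q => by apply Complex.ext <;> simp <;> ring
      map_smul' := fun r q => by apply Complex.ext <;> simp <;> ring }

/-- The embedding of `ℂ` in the quaternions with image `ℝ + ℝj`. -/
noncomputable def embJ : ℂ →L[ℝ] ℍ[ℝ] :=
  LinearMap.toContinuousLinearMap
    { toFun := fun c => (c.re : ℍ[ℝ]) + c.im • qj
      map_add' := fun p q => by
        simp only [Complex.add_re, Complex.add_im, Quaternion.coe_add, add_smul]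
        abel
      map_smul' := fun r q => by
        simp only [Complex.smul_re, Complex.smul_im, smul_eq_mul, Quaternion.coe_mul, mul_smul,
          RingHom.id_apply, smul_add, Quaternion.coe_mul_eq_smul] }

theorem embJ_apply (c : ℂ) : embJ c = (c.re : ℍ[ℝ]) + c.im • qj := rfl

theorem posPart_apply (q : ℍ[ℝ]) : posPart q = ⟨q.re + q.imK, q.imJ - q.imI⟩ := rfl

theorem negPart_apply (q : ℍ[ℝ]) : negPart q = ⟨q.re - q.imK, q.imJ + q.imI⟩ := rfl

theorem re_embJ (c : ℂ) : (embJ c).re = c.re := by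
  rw [embJ_apply]
  simp
  simp [qj]

theorem imI_embJ (c : ℂ) : (embJ c).imI = 0 := by
  rw [embJ_apply]
  simp
  simp [qj]

theorem imJ_embJ (c : ℂ) : (embJ c).imJ = c.im := by
  rw [embJ_apply]
  simp
  simp [qj]

theorem imK_embJ (c : ℂ) : (embJ c).imK = 0 := by
  rw [embJ_apply]
  simp
  simp [qj]

theorem posPart_mul_embJ (q : ℍ[ℝ]) (c : ℂ) : posPart (q * embJ c) = posPart q * c := by
  rw [posPart_apply, posPart_apply]
  apply Complex.ext <;> simp [re_embJ, imI_embJ, imJ_embJ, imK_embJ] <;> ring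

theorem negPart_mul_embJ (q : ℍ[ℝ]) (c : ℂ) : negPart (q * embJ c) = negPart q * c := by
  rw [negPart_apply, negPart_apply]
  apply Complex.ext <;> simp [re_embJ, imI_embJ, imJ_embJ, imK_embJ] <;> ring

theorem posPart_embJ (c : ℂ) : posPart (embJ c) = c := by
  apply Complex.ext <;> simp [posPart_apply, re_embJ, imI_embJ, imJ_embJ, imK_embJ]

theorem negPart_embJ (c : ℂ) : negPart (embJ c) = c := by
  apply Complex.ext <;> simp [negPart_apply, re_embJ, imI_embJ, imJ_embJ, imK_embJ]

theorem star_embJ (c : ℂ) : star (embJ c) = embJ (star c) := by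
  apply Quaternion.ext <;> simp [re_embJ, imI_embJ, imJ_embJ, imK_embJ]

theorem norm_sq_eq (q : ℍ[ℝ]) : ‖q‖ ^ 2 = q.re ^ 2 + q.imI ^ 2 + q.imJ ^ 2 + q.imK ^ 2 := by
  rw [← Quaternion.normSq_def', Quaternion.normSq_eq_norm_mul_self, sq]

/-- The two summands of the decomposition are orthogonal, and |(1 ± k)/2|² = 1/2 accounts for the
factor 2. -/
theorem norm_posPart_sq_add (q : ℍ[ℝ]) : ‖posPart q‖ ^ 2 + ‖negPart q‖ ^ 2 = 2 * ‖q‖ ^ 2 := by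
  rw [norm_sq_eq, ← Complex.normSq_eq_norm_sq, ← Complex.normSq_eq_norm_sq, posPart_apply,
    negPart_apply, Complex.normSq_mk, Complex.normSq_mk]
  ring

theorem enorm_posPart_sq_add (q : ℍ[ℝ]) : ‖posPart q‖ₑ ^ 2 + ‖negPart q‖ₑ ^ 2 = 2 * ‖q‖ₑ ^ 2 := by
  have := congrArg ENNReal.ofReal (norm_posPart_sq_add q)
  rw [ENNReal.ofReal_add (by positivity) (by positivity), ENNReal.ofReal_mul (by norm_num)] at this
  simpa only [ENNReal.ofReal_pow (norm_nonneg _), ofReal_norm, ENNReal.ofReal_ofNat] using this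

theorem norm_embJ (c : ℂ) : ‖embJ c‖ = ‖c‖ := by
  have := norm_posPart_sq_add (embJ c)
  rw [posPart_embJ, negPart_embJ] at this
  exact ((pow_left_inj₀ (norm_nonneg _) (norm_nonneg _) two_ne_zero).1 (by linarith)).symm

theorem embJ_negPart {q : ℍ[ℝ]} (h : posPart q = negPart q) : embJ (negPart q) = q := by
  have h1 := congrArg Complex.re h
  have h2 := congrArg Complex.im h
  simp only [posPart_apply, negPart_apply] at h1 h2
  apply Quaternion.ext <;>
    simp only [re_embJ, imI_embJ, imJ_embJ, imK_embJ, negPart_apply] <;> linarith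

theorem exp_smul_unit {q : ℍ[ℝ]} (h0 : q.re = 0) (h1 : ‖q‖ = 1) (t : ℝ) :
    NormedSpace.exp (t • q) = (Real.cos t : ℍ[ℝ]) + Real.sin t • q := by
  rw [Quaternion.exp_of_re_eq_zero _ (by simp [h0]), norm_smul, h1, mul_one, Real.norm_eq_abs,
    Real.cos_abs, smul_smul]
  congr 2
  rcases lt_trichotomy t 0 with ht | rfl | ht
  · rw [abs_of_neg ht, Real.sin_neg]; field_simp [ht.ne]
  · simp
  · rw [abs_of_pos ht]; field_simp

theorem norm_qi : ‖qi‖ = 1 := by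
  refine (pow_eq_one_iff_of_nonneg (norm_nonneg _) two_ne_zero).1 ((norm_sq_eq qi).trans ?_)
  norm_num [qi]

theorem norm_qj : ‖qj‖ = 1 := by
  refine (pow_eq_one_iff_of_nonneg (norm_nonneg _) two_ne_zero).1 ((norm_sq_eq qj).trans ?_)
  norm_num [qj]

theorem expI_eq (t : ℝ) : expI t = (Real.cos t : ℍ[ℝ]) + Real.sin t • qi :=
  exp_smul_unit rfl norm_qi t

theorem expJ_eq (t : ℝ) : expJ t = embJ (cexp (t * I)) := by
  rw [expJ, exp_smul_unit rfl norm_qj]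
  apply Quaternion.ext <;>
    simp [re_embJ, imI_embJ, imJ_embJ, imK_embJ, Complex.exp_ofReal_mul_I_re,
      Complex.exp_ofReal_mul_I_im] <;> simp [qj]

theorem re_expI (t : ℝ) : (expI t).re = Real.cos t := by
  rw [expI_eq]
  simp
  simp [qi]

theorem imI_expI (t : ℝ) : (expI t).imI = Real.sin t := by
  rw [expI_eq]
  simp
  simp [qi]

theorem imJ_expI (t : ℝ) : (expI t).imJ = 0 := by
  rw [expI_eq]
  simp
  simp [qi]

theorem imK_expI (t : ℝ) : (expI t).imK = 0 := by
  rw [expI_eq]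
  simp
  simp [qi]

theorem norm_expI (t : ℝ) : ‖expI t‖ = 1 := by
  refine (pow_eq_one_iff_of_nonneg (norm_nonneg _) two_ne_zero).1 ((norm_sq_eq _).trans ?_)
  simp [re_expI, imI_expI, imJ_expI, imK_expI]

theorem norm_expJ (t : ℝ) : ‖expJ t‖ = 1 := by
  rw [expJ_eq, norm_embJ, Complex.norm_exp_ofReal_mul_I]

theorem continuous_expI : Continuous expI := by
  rw [funext expI_eq]
  exact (Quaternion.continuous_coe.comp Real.continuous_cos).add
    (Real.continuous_sin.smul continuous_const)

theorem continuous_expJ : Continuous expJ := by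
  rw [funext expJ_eq]
  exact embJ.continuous.comp (by fun_prop)

/-- Because i(1+k) = (1+k)(-j), left multiplication by i acts on this coordinate as -j; for the
other one, i(1-k) = (1-k)j. -/
theorem posPart_expI_mul (t : ℝ) (q : ℍ[ℝ]) :
    posPart (expI t * q) = cexp (((-t : ℝ) : ℂ) * I) * posPart q := by
  rw [posPart_apply, posPart_apply]
  apply Complex.ext <;>
    simp only [Complex.mul_re, Complex.mul_im, Complex.exp_ofReal_mul_I_re,
      Complex.exp_ofReal_mul_I_im, Real.cos_neg, Real.sin_neg, Quaternion.re_mul, Quaternion.imI_mul,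
      Quaternion.imJ_mul, Quaternion.imK_mul, re_expI, imI_expI, imJ_expI, imK_expI] <;> ring

theorem negPart_expI_mul (t : ℝ) (q : ℍ[ℝ]) :
    negPart (expI t * q) = cexp ((t : ℂ) * I) * negPart q := by
  rw [negPart_apply, negPart_apply]
  apply Complex.ext <;>
    simp only [Complex.mul_re, Complex.mul_im, Complex.exp_ofReal_mul_I_re,
      Complex.exp_ofReal_mul_I_im, Quaternion.re_mul, Quaternion.imI_mul,
      Quaternion.imJ_mul, Quaternion.imK_mul, re_expI, imI_expI, imJ_expI, imK_expI] <;> ring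

theorem expI_neg_mul_qj (t : ℝ) : expI (-t) * qj = qj * expI t := by
  apply Quaternion.ext <;>
    simp [re_expI, imI_expI, imJ_expI, imK_expI] <;> simp [qj]

theorem expJ_zero : expJ 0 = 1 := by simp [expJ]

/-- Since e^{jπ/2} = j, the hypothesis places q in the centralizer ℝ + ℝj of j, where the two
coordinates agree. -/
theorem posPart_eq_negPart_of_commute {q : ℍ[ℝ]}
    (h : q * expJ (Real.pi / 2) = expJ (Real.pi / 2) * q) : posPart q = negPart q := by
  have hj : cexp (((Real.pi / 2 : ℝ) : ℂ) * I) = I := by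
    push_cast
    exact Complex.exp_pi_div_two_mul_I
  rw [expJ_eq, hj] at h
  have h1 := congrArg QuaternionAlgebra.imI h
  have h2 := congrArg QuaternionAlgebra.imK h
  simp only [Quaternion.imI_mul, Quaternion.imK_mul, re_embJ, imI_embJ, imJ_embJ, imK_embJ,
    I_re, I_im] at h1 h2
  rw [posPart_apply, negPart_apply]
  apply Complex.ext <;> simp only <;> linarith

/-! ### The quaternion Fourier transform in coordinates -/

theorem two_pi_inv_pos : 0 < (2 * Real.pi)⁻¹ := by positivity

theorem ofReal_two_pi_inv_ne_zero : ENNReal.ofReal (2 * Real.pi)⁻¹ ≠ 0 := by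
  simpa using Real.pi_pos

theorem ae_mu2 : ae mu2 = ae volume :=
  Measure.ae_ennreal_smul_measure_eq ofReal_two_pi_inv_ne_zero _

theorem memLp_mu2_iff {E : Type*} [NormedAddCommGroup E] {g : ℝ × ℝ → E} {p : ℝ≥0∞} :
    MemLp g p mu2 ↔ MemLp g p := by
  refine ⟨fun h => ?_, fun h => h.smul_measure ENNReal.ofReal_ne_top⟩
  refine h.of_measure_le_smul (c := (ENNReal.ofReal (2 * Real.pi)⁻¹)⁻¹)
    (ENNReal.inv_ne_top.2 ofReal_two_pi_inv_ne_zero) ?_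
  rw [mu2, smul_smul, ENNReal.inv_mul_cancel ofReal_two_pi_inv_ne_zero ENNReal.ofReal_ne_top,
    one_smul]

theorem integral_mu2 {E : Type*} [NormedAddCommGroup E] [NormedSpace ℝ E] (g : ℝ × ℝ → E) :
    ∫ x, g x ∂mu2 = (2 * Real.pi)⁻¹ • ∫ x, g x := by
  rw [mu2, integral_smul_measure, ENNReal.toReal_ofReal two_pi_inv_pos.le]

theorem lintegral_mu2 (g : ℝ × ℝ → ℝ≥0∞) :
    ∫⁻ x, g x ∂mu2 = ENNReal.ofReal (2 * Real.pi)⁻¹ * ∫⁻ x, g x := by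
  rw [mu2, lintegral_smul_measure, smul_eq_mul]

theorem integrable_qFourier {g : ℝ × ℝ → ℍ[ℝ]} (hg : MemLp g 1) (w : ℝ × ℝ) :
    Integrable fun x : ℝ × ℝ => expI (-(x.1 * w.1)) * g x * expJ (-(x.2 * w.2)) := by
  have hI := continuous_expI
  have hJ := continuous_expJ
  refine (memLp_one_iff_integrable.1 hg).congr' ?_ (.of_forall fun x => ?_)
  · exact ((Continuous.aestronglyMeasurable (by fun_prop)).mul hg.1).mul
      (Continuous.aestronglyMeasurable (by fun_prop))
  · simp only [norm_mul, norm_expI, norm_expJ, one_mul, mul_one]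

theorem posPart_qFourier {g : ℝ × ℝ → ℍ[ℝ]} (hg : MemLp g 1) (w : ℝ × ℝ) :
    posPart (qFourier g w) = (2 * Real.pi)⁻¹ •
      planeFourier (fun x => posPart (g x)) (-w.1 / (2 * Real.pi), w.2 / (2 * Real.pi)) := by
  have hpi := Real.pi_ne_zero
  rw [qFourier, integral_mu2, map_smul, ← posPart.integral_comp_comm (integrable_qFourier hg w),
    planeFourier]
  congr 1
  refine integral_congr_ae (.of_forall fun x => ?_)
  simp only [expJ_eq, posPart_mul_embJ, posPart_expI_mul]
  rw [mul_right_comm, ← Complex.exp_add, ← add_mul, ← ofReal_add]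
  congr 4
  field_simp
  ring

theorem negPart_qFourier {g : ℝ × ℝ → ℍ[ℝ]} (hg : MemLp g 1) (w : ℝ × ℝ) :
    negPart (qFourier g w) = (2 * Real.pi)⁻¹ •
      planeFourier (fun x => negPart (g x)) (w.1 / (2 * Real.pi), w.2 / (2 * Real.pi)) := by
  have hpi := Real.pi_ne_zero
  rw [qFourier, integral_mu2, map_smul, ← negPart.integral_comp_comm (integrable_qFourier hg w),
    planeFourier]
  congr 1
  refine integral_congr_ae (.of_forall fun x => ?_)
  simp only [expJ_eq, negPart_mul_embJ, negPart_expI_mul]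
  rw [mul_right_comm, ← Complex.exp_add, ← add_mul, ← ofReal_add]
  congr 4
  field_simp
  ring

theorem qFourier_qj_mul {g : ℝ × ℝ → ℍ[ℝ]} (hg : MemLp g 1) (u v : ℝ) :
    qFourier (fun x => qj * g x) (u, v) = qj * qFourier g (-u, v) := by
  have h := (ContinuousLinearMap.mul ℝ ℍ[ℝ] qj).integral_comp_comm (integrable_qFourier hg (-u, v))
  simp only [ContinuousLinearMap.mul_apply'] at h
  rw [qFourier, qFourier, integral_mu2, integral_mu2, mul_smul_comm, ← h]
  congr 1
  refine integral_congr_ae (.of_forall fun x => ?_)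
  simp only [mul_neg, neg_neg, ← mul_assoc, expI_neg_mul_qj]

/-- Moving j across e^{-ixu} reverses the sign of u; the second window identity at y = 0 then reads
jF_Q(-u, v) = jF_Q(u, v). -/
theorem ConvCondition.qFourier_even {g : ℝ × ℝ → ℍ[ℝ]} (h : ConvCondition g) (hg : MemLp g 1)
    (u v : ℝ) : qFourier g (-u, v) = qFourier g (u, v) := by
  have := h.mul_j u v 0
  rw [mul_zero, neg_zero, expJ_zero, mul_one, mul_one, qFourier_qj_mul hg] at this
  have hj : qj ≠ 0 := fun h0 => by
    have := congrArg QuaternionAlgebra.imJ h0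
    simp [qj] at this
  exact mul_left_cancel₀ hj this

/-- A window satisfying the convolution condition takes its values in `ℝ + ℝj`, and its Fourier
transform is even in the first variable. -/
theorem ConvCondition.exists_complex_window {φ : ℝ × ℝ → ℍ[ℝ]} (h : ConvCondition φ)
    (h1 : MemLp φ 1) (h2 : MemLp φ 2) :
    ∃ a : ℝ × ℝ → ℂ, StronglyMeasurable a ∧ MemLp a 1 ∧ MemLp a 2 ∧
      (∀ᵐ x, φ x = embJ (a x)) ∧
      ∀ u v : ℝ, planeFourier a (-u, v) = planeFourier a (u, v) := by
  have hpi := Real.pi_ne_zero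
  have p1 : MemLp (fun x => posPart (φ x)) 1 := posPart.comp_memLp' h1
  have p2 : MemLp (fun x => posPart (φ x)) 2 := posPart.comp_memLp' h2
  have n1 : MemLp (fun x => negPart (φ x)) 1 := negPart.comp_memLp' h1
  have n2 : MemLp (fun x => negPart (φ x)) 2 := negPart.comp_memLp' h2
  have hscale : ∀ u : ℝ, 2 * Real.pi * u / (2 * Real.pi) = u := fun u => by field_simp
  have hinv : (2 * Real.pi)⁻¹ ≠ 0 := two_pi_inv_pos.ne'
  have heven : ∀ u v : ℝ, planeFourier (fun x => negPart (φ x)) (-u, v) =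
      planeFourier (fun x => negPart (φ x)) (u, v) := by
    intro u v
    have := congrArg negPart (h.qFourier_even h1 (2 * Real.pi * u) (2 * Real.pi * v))
    rw [negPart_qFourier h1, negPart_qFourier h1] at this
    simpa only [neg_div, hscale] using smul_right_injective ℂ hinv this
  have hpn : planeFourier (fun x => posPart (φ x)) =ᵐ[volume]
      planeFourier (fun x => negPart (φ x)) := by
    filter_upwards [ae_ne_zero] with w hw
    have hv : 2 * Real.pi * w.2 ≠ 0 := by simp [hw.2]
    -- This y makes the exponential e^{jπ/2} = j, which requires v ≠ 0, hence the almost everywhere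
    -- statement.
    have hc := h.comm (2 * Real.pi * -w.1) (2 * Real.pi * w.2)
      (-(Real.pi / 2) / (2 * Real.pi * w.2))
    rw [mul_div_cancel₀ _ hv, neg_neg] at hc
    have := posPart_eq_negPart_of_commute hc
    rw [posPart_qFourier h1, negPart_qFourier h1] at this
    have := smul_right_injective ℂ hinv this
    simp only [hscale, mul_neg, neg_neg, neg_div] at this
    rw [this, heven]
  have hae := ae_eq_of_planeFourier_ae_eq p1 p2 n1 n2 hpn
  -- A strongly measurable representative secures joint measurability in (ξ, b) later.
  have hmk := n1.1.ae_eq_mk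
  refine ⟨n1.1.mk _, n1.1.stronglyMeasurable_mk, (memLp_congr_ae hmk).1 n1,
    (memLp_congr_ae hmk).1 n2, ?_, fun u v => ?_⟩
  · filter_upwards [hae, hmk] with x hx hx'
    rw [← hx', embJ_negPart hx]
  · have hcongr : planeFourier (n1.1.mk _) = planeFourier (fun x => negPart (φ x)) := by
      funext w
      refine integral_congr_ae ?_
      filter_upwards [hmk] with x hx
      rw [hx]
    rw [hcongr, heven]

theorem planeFourier_star (a : ℝ × ℝ → ℂ) (w : ℝ × ℝ) :
    planeFourier (fun x => star (a x)) w = star (planeFourier a (-w)) := by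
  rw [planeFourier, planeFourier, Complex.star_def, ← integral_conj]
  refine integral_congr_ae (.of_forall fun x => ?_)
  simp only [map_mul, ← Complex.exp_conj, conj_ofReal, conj_I]
  congr 2
  simp only [Prod.fst_neg, Prod.snd_neg]
  push_cast
  ring

theorem qFourier_congr_ae {g h : ℝ × ℝ → ℍ[ℝ]} (hgh : ∀ᵐ x, g x = h x) :
    qFourier g = qFourier h := by
  funext w
  refine integral_congr_ae ?_
  rw [Filter.EventuallyEq, ae_mu2]
  filter_upwards [hgh] with x hx
  rw [hx]

/-- By evenness both coordinates of F_Q(conj φ) have the same modulus, so the factor 2 in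
`norm_posPart_sq_add` cancels. -/
theorem norm_qFourier_star {φ : ℝ × ℝ → ℍ[ℝ]} {a : ℝ × ℝ → ℂ} (a1 : MemLp a 1)
    (hφ : ∀ᵐ x, φ x = embJ (a x))
    (heven : ∀ u v : ℝ, planeFourier a (-u, v) = planeFourier a (u, v)) (w : ℝ × ℝ) :
    ‖qFourier (fun x => star (φ x)) w‖ =
      (2 * Real.pi)⁻¹ * ‖planeFourier a (-w.1 / (2 * Real.pi), -w.2 / (2 * Real.pi))‖ := by
  have hs : MemLp (fun x => embJ (star (a x))) 1 := embJ.comp_memLp' a1.star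
  have hcongr : qFourier (fun x => star (φ x)) = qFourier fun x => embJ (star (a x)) := by
    refine qFourier_congr_ae ?_
    filter_upwards [hφ] with x hx
    rw [hx, star_embJ]
  have hp := posPart_qFourier hs w
  have hn := negPart_qFourier hs w
  have key := norm_posPart_sq_add (qFourier (fun x => embJ (star (a x))) w)
  simp only [posPart_embJ, negPart_embJ, planeFourier_star, Prod.neg_mk] at hp hn
  rw [neg_div, neg_neg, ← heven] at hp
  rw [hp, hn, norm_smul, norm_star,
    Real.norm_of_nonneg two_pi_inv_pos.le] at key
  rw [hcongr, neg_div, neg_div]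
  exact (pow_left_inj₀ (norm_nonneg _) (by positivity) two_ne_zero).1 (by linarith)

/-- The cube of (2π)⁻¹ collects one factor from μ₂ and two from the squared modulus of F_Q. -/
theorem ofReal_admConst {φ : ℝ × ℝ → ℍ[ℝ]} {a : ℝ × ℝ → ℂ} (hint : Integrable (admIntegrand φ) mu2)
    (a1 : MemLp a 1) (hφ : ∀ᵐ x, φ x = embJ (a x))
    (heven : ∀ u v : ℝ, planeFourier a (-u, v) = planeFourier a (u, v)) :
    ENNReal.ofReal (admConst φ) = ENNReal.ofReal (2 * Real.pi)⁻¹ ^ 3 *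
      ∫⁻ ξ, ENNReal.ofReal |detA ξ|⁻¹ *
        ‖planeFourier a ((ξ.1 - 1) / (2 * Real.pi), (ξ.2 - 1) / (2 * Real.pi))‖ₑ ^ 2 := by
  rw [admConst, ofReal_integral_eq_lintegral_ofReal hint
    (.of_forall fun ξ => div_nonneg (sq_nonneg _) (abs_nonneg _)), lintegral_mu2, pow_succ',
    mul_assoc, ← lintegral_const_mul' (ENNReal.ofReal (2 * Real.pi)⁻¹ ^ 2) _ (by simp)]
  congr 1
  refine lintegral_congr fun ξ => ?_
  rw [admIntegrand, norm_qFourier_star a1 hφ heven, mul_pow, div_eq_mul_inv,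
    ENNReal.ofReal_mul (by positivity), ENNReal.ofReal_mul (by positivity),
    ENNReal.ofReal_pow two_pi_inv_pos.le, ENNReal.ofReal_pow (norm_nonneg _), ofReal_norm, mul_assoc]
  congr 1
  rw [mul_comm]
  simp only [Prod.fst_sub, Prod.snd_sub, neg_sub]

/-! ### Plancherel for the quaternion Stockwell transform -/

theorem stockwell_of_detA_eq_zero (φ f : ℝ × ℝ → ℍ[ℝ]) {p : (ℝ × ℝ) × (ℝ × ℝ)}
    (hp : detA p.1 = 0) : stockwell φ f p = 0 := by
  rw [stockwell, hp, abs_zero, Real.sqrt_zero, zero_smul]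

theorem stockwell_congr_ae {φ ψ f g : ℝ × ℝ → ℍ[ℝ]} (hφ : ∀ᵐ x, φ x = ψ x)
    (hf : ∀ᵐ x, f x = g x) : stockwell φ f = stockwell ψ g := by
  funext p
  by_cases hp : detA p.1 = 0
  · rw [stockwell_of_detA_eq_zero φ f hp, stockwell_of_detA_eq_zero ψ g hp]
  · rw [stockwell, stockwell]
    congr 1
    refine integral_congr_ae ?_
    rw [Filter.EventuallyEq, ae_mu2]
    filter_upwards [hf, ae_comp_mulA_sub hp p.2 hφ] with x hx hx'
    rw [hx, hx']

theorem integrable_stockwell {φ f : ℝ × ℝ → ℍ[ℝ]} (hφ : MemLp φ 2) (hf : MemLp f 2)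
    {p : (ℝ × ℝ) × (ℝ × ℝ)} (hp : detA p.1 ≠ 0) :
    Integrable fun x : ℝ × ℝ => expI (-(x.1 * p.1.1)) * f x * expJ (-(x.2 * p.1.2)) *
      star (φ (mulA p.1 (x - p.2))) := by
  have hI := continuous_expI
  have hJ := continuous_expJ
  have h1 : MemLp (fun x : ℝ × ℝ => expI (-(x.1 * p.1.1)) * f x * expJ (-(x.2 * p.1.2))) 2 := by
    refine hf.congr_norm ?_ (.of_forall fun x => ?_)
    · exact ((Continuous.aestronglyMeasurable (by fun_prop)).mul hf.1).mul
        (Continuous.aestronglyMeasurable (by fun_prop))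
    · simp only [norm_mul, norm_expI, norm_expJ, one_mul, mul_one]
  have h2 : MemLp (fun x : ℝ × ℝ => star (φ (mulA p.1 (x - p.2)))) 2 :=
    (memLp_comp_mulA_sub hp p.2 hφ).star
  exact h1.integrable_mul h2

theorem posPart_stockwell {a : ℝ × ℝ → ℂ} {f : ℝ × ℝ → ℍ[ℝ]} (ha : MemLp a 2) (hf : MemLp f 2)
    (p : (ℝ × ℝ) × (ℝ × ℝ)) :
    posPart (stockwell (fun x => embJ (a x)) f p) = Real.sqrt |detA p.1| • (2 * Real.pi)⁻¹ •
      ∫ x, posPart (f x) * star (stockAtom a (-1) p x) := by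
  by_cases hp : detA p.1 = 0
  · rw [stockwell_of_detA_eq_zero _ _ hp, hp, abs_zero, Real.sqrt_zero, zero_smul, map_zero]
  have hint := integrable_stockwell (embJ.comp_memLp' ha) hf hp
  simp only [Function.comp_apply] at hint
  rw [stockwell, integral_mu2, map_smul, map_smul, ← posPart.integral_comp_comm hint]
  congr 2
  refine integral_congr_ae (.of_forall fun x => ?_)
  simp only [expJ_eq, star_embJ, posPart_mul_embJ, posPart_expI_mul, stockAtom, star_mul',
    Complex.star_def, ← Complex.exp_conj, map_mul, conj_ofReal, conj_I, ← mul_assoc]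
  congr 1
  rw [mul_right_comm, ← Complex.exp_add, mul_comm]
  congr 2
  push_cast
  ring

theorem negPart_stockwell {a : ℝ × ℝ → ℂ} {f : ℝ × ℝ → ℍ[ℝ]} (ha : MemLp a 2) (hf : MemLp f 2)
    (p : (ℝ × ℝ) × (ℝ × ℝ)) :
    negPart (stockwell (fun x => embJ (a x)) f p) = Real.sqrt |detA p.1| • (2 * Real.pi)⁻¹ •
      ∫ x, negPart (f x) * star (stockAtom a 1 p x) := by
  by_cases hp : detA p.1 = 0
  · rw [stockwell_of_detA_eq_zero _ _ hp, hp, abs_zero, Real.sqrt_zero, zero_smul, map_zero]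
  have hint := integrable_stockwell (embJ.comp_memLp' ha) hf hp
  simp only [Function.comp_apply] at hint
  rw [stockwell, integral_mu2, map_smul, map_smul, ← negPart.integral_comp_comm hint]
  congr 2
  refine integral_congr_ae (.of_forall fun x => ?_)
  simp only [expJ_eq, star_embJ, negPart_mul_embJ, negPart_expI_mul, stockAtom, star_mul',
    Complex.star_def, ← Complex.exp_conj, map_mul, conj_ofReal, conj_I, ← mul_assoc]
  congr 1
  rw [mul_right_comm, ← Complex.exp_add, mul_comm]
  congr 2
  push_cast
  ring

theorem measurable_integral_stockAtom {a F : ℝ × ℝ → ℂ} (ha : Measurable a) (hF : Measurable F)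
    (σ : ℝ) : Measurable fun p => ∫ x, F x * star (stockAtom a σ p x) := by
  have hatom : Measurable fun q : ((ℝ × ℝ) × (ℝ × ℝ)) × (ℝ × ℝ) => stockAtom a σ q.1 q.2 := by
    unfold stockAtom
    have hm : Measurable fun q : ((ℝ × ℝ) × (ℝ × ℝ)) × (ℝ × ℝ) =>
        mulA q.1.1 (q.2 - q.1.2) :=
      measurable_mulA.comp (measurable_fst.fst.prodMk (measurable_snd.sub measurable_fst.snd))
    have ha' := ha.comp hm
    simp only [Function.comp_def] at ha'
    fun_prop
  have h : Measurable fun q : ((ℝ × ℝ) × (ℝ × ℝ)) × (ℝ × ℝ) =>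
      F q.2 * star (stockAtom a σ q.1 q.2) :=
    (hF.comp measurable_snd).mul (continuous_star.measurable.comp hatom)
  exact h.stronglyMeasurable.integral_prod_right.measurable

/-- The integral of `|S|²` over phase space, for one complex component of the transform. -/
theorem lintegral_component {a F : ℝ × ℝ → ℂ} (ha : Measurable a) (hFm : Measurable F)
    (hF : MemLp F 2) (a1 : MemLp a 1) (a2 : MemLp a 2)
    (heven : ∀ u v : ℝ, planeFourier a (-u, v) = planeFourier a (u, v))
    {σ : ℝ} (hσ : σ = 1 ∨ σ = -1) :
    ∫⁻ p, ‖Real.sqrt |detA p.1| • (2 * Real.pi)⁻¹ •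
        ∫ x, F x * star (stockAtom a σ p x)‖ₑ ^ 2 =
      ENNReal.ofReal (2 * Real.pi)⁻¹ ^ 2 * ((∫⁻ x, ‖F x‖ₑ ^ 2) *
        ∫⁻ ξ, ENNReal.ofReal |detA ξ|⁻¹ *
          ‖planeFourier a ((ξ.1 - 1) / (2 * Real.pi), (ξ.2 - 1) / (2 * Real.pi))‖ₑ ^ 2) := by
  rw [← lintegral_energy_stockAtom hF a1 a2 heven hσ,
    ← lintegral_const_mul' _ _ (by simp)]
  have hm := measurable_integral_stockAtom ha hFm σ
  have hdet := measurable_detA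
  have hmeas : Measurable fun p : (ℝ × ℝ) × (ℝ × ℝ) => ‖Real.sqrt |detA p.1| • (2 * Real.pi)⁻¹ •
        ∫ x, F x * star (stockAtom a σ p x)‖ₑ ^ 2 := by
    refine Measurable.pow_const (Measurable.enorm ?_) 2
    have hs : Measurable fun p : (ℝ × ℝ) × (ℝ × ℝ) => Real.sqrt |detA p.1| := by fun_prop
    exact hs.smul (hm.fun_const_smul _)
  rw [Measure.volume_eq_prod (ℝ × ℝ) (ℝ × ℝ), lintegral_prod _ hmeas.aemeasurable]
  refine lintegral_congr fun ξ => ?_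
  rw [← lintegral_const_mul' _ _ ENNReal.ofReal_ne_top, ← lintegral_const_mul' _ _ (by simp)]
  refine lintegral_congr fun b => ?_
  rw [enorm_smul, enorm_smul, mul_pow, mul_pow, Real.enorm_of_nonneg (Real.sqrt_nonneg _),
    Real.enorm_of_nonneg two_pi_inv_pos.le, ← ENNReal.ofReal_pow (Real.sqrt_nonneg _),
    Real.sq_sqrt (abs_nonneg _)]
  ring

/-- Plancherel's formula for the continuous quaternion Stockwell transform. -/
theorem lintegral_stockwell {φ f : ℝ × ℝ → ℍ[ℝ]} (hφ : IsAdmissible φ) (hconv : ConvCondition φ)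
    (hf : MemLp f 2 mu2) :
    ∫⁻ p, ‖stockwell φ f p‖ₑ ^ 2 ∂mu4 =
      ENNReal.ofReal (admConst φ) * ∫⁻ x, ‖f x‖ₑ ^ 2 ∂mu2 := by
  obtain ⟨a, ham, a1, a2, hφa, heven⟩ := hconv.exists_complex_window
    (memLp_mu2_iff.1 hφ.memLp_one) (memLp_mu2_iff.1 hφ.memLp_two)
  have hf' : MemLp f 2 := memLp_mu2_iff.1 hf
  set g := hf'.1.mk f with hg
  have hfg : f =ᵐ[volume] g := hf'.1.ae_eq_mk
  have hgm : StronglyMeasurable g := hf'.1.stronglyMeasurable_mk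
  have hg2 : MemLp g 2 := (memLp_congr_ae hfg).1 hf'
  have hpm : Measurable fun x => posPart (g x) :=
    (posPart.continuous.comp_stronglyMeasurable hgm).measurable
  have hnm : Measurable fun x => negPart (g x) :=
    (negPart.continuous.comp_stronglyMeasurable hgm).measurable
  have hS : stockwell φ f = stockwell (fun x => embJ (a x)) g := stockwell_congr_ae hφa hfg
  have hnormf : ∫⁻ x, ‖f x‖ₑ ^ 2 = ∫⁻ x, ‖g x‖ₑ ^ 2 := by
    refine lintegral_congr_ae ?_
    filter_upwards [hfg] with x hx
    rw [hx]
  have hp := lintegral_component ham.measurable hpm (posPart.comp_memLp' hg2) a1 a2 heven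
    (Or.inr rfl)
  have hn := lintegral_component ham.measurable hnm (negPart.comp_memLp' hg2) a1 a2 heven
    (Or.inl rfl)
  set K := ∫⁻ ξ, ENNReal.ofReal |detA ξ|⁻¹ *
    ‖planeFourier a ((ξ.1 - 1) / (2 * Real.pi), (ξ.2 - 1) / (2 * Real.pi))‖ₑ ^ 2 with hK
  have hdet := measurable_detA
  have hsplit : 2 * ∫⁻ p, ‖stockwell φ f p‖ₑ ^ 2 =
      ENNReal.ofReal (2 * Real.pi)⁻¹ ^ 2 * ((2 * ∫⁻ x, ‖g x‖ₑ ^ 2) * K) := by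
    rw [← lintegral_const_mul' 2 _ (by simp), ← lintegral_const_mul' 2 _ (by simp), hS]
    simp only [← enorm_posPart_sq_add]
    simp only [posPart_stockwell a2 hg2, negPart_stockwell a2 hg2]
    rw [lintegral_add_left, lintegral_add_left, hp, hn]
    · ring
    · exact hpm.enorm.pow_const 2
    · have hm := measurable_integral_stockAtom ham.measurable hpm (-1)
      refine Measurable.pow_const (Measurable.enorm ?_) 2
      have hs : Measurable fun p : (ℝ × ℝ) × (ℝ × ℝ) => Real.sqrt |detA p.1| := by fun_prop
      exact hs.smul (hm.fun_const_smul _)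
  have hmain : ∫⁻ p, ‖stockwell φ f p‖ₑ ^ 2 =
      ENNReal.ofReal (2 * Real.pi)⁻¹ ^ 2 * ((∫⁻ x, ‖g x‖ₑ ^ 2) * K) := by
    refine (ENNReal.mul_right_inj (a := 2) (by norm_num) (by norm_num)).1 (hsplit.trans ?_)
    ring
  -- Both sides carry (2π)⁻⁴: 2 + 2 from μ₄ and the squared transform, 3 + 1 from C_φ and μ₂.
  rw [mu4, lintegral_smul_measure, smul_eq_mul, hmain, lintegral_mu2, hnormf,
    ofReal_admConst hφ.integrable a1 hφa heven, ← inv_pow, ENNReal.ofReal_pow two_pi_inv_pos.le]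
  ring

/-! ### The pointwise bound -/

theorem lintegral_enorm_mul_sq_le {α E : Type*} [MeasurableSpace α] {μ : Measure α}
    [NormedAddCommGroup E] {f g : α → E}
    (hf : AEStronglyMeasurable f μ) (hg : AEStronglyMeasurable g μ) :
    (∫⁻ x, ‖f x‖ₑ * ‖g x‖ₑ ∂μ) ^ 2 ≤ (∫⁻ x, ‖f x‖ₑ ^ 2 ∂μ) * ∫⁻ x, ‖g x‖ₑ ^ 2 ∂μ := by
  have h := ENNReal.lintegral_mul_le_Lp_mul_Lq μ Real.HolderConjugate.two_two hf.enorm hg.enorm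
  rw [← ENNReal.mul_rpow_of_nonneg _ _ (by norm_num)] at h
  have h2 := pow_le_pow_left₀ (zero_le) h 2
  rw [← ENNReal.rpow_mul_natCast] at h2
  simpa using h2

/-- The pointwise bound `|S_φ f| ≤ ‖f‖₂ ‖φ‖₂` for the quaternion Stockwell transform. -/
theorem enorm_stockwell_sq_le {φ f : ℝ × ℝ → ℍ[ℝ]} (hφ : MemLp φ 2 mu2) (hf : MemLp f 2 mu2)
    (p : (ℝ × ℝ) × (ℝ × ℝ)) :
    ‖stockwell φ f p‖ₑ ^ 2 ≤ (∫⁻ x, ‖f x‖ₑ ^ 2 ∂mu2) * ∫⁻ x, ‖φ x‖ₑ ^ 2 ∂mu2 := by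
  by_cases hp : detA p.1 = 0
  · rw [stockwell_of_detA_eq_zero _ _ hp]
    simp
  have hpos : 0 < |detA p.1| := abs_pos.2 hp
  have hφ' := memLp_comp_mulA_sub hp p.2 (memLp_mu2_iff.1 hφ)
  have hint : ‖∫ x, expI (-(x.1 * p.1.1)) * f x * expJ (-(x.2 * p.1.2)) *
      star (φ (mulA p.1 (x - p.2))) ∂mu2‖ₑ ≤ ∫⁻ x, ‖f x‖ₑ * ‖φ (mulA p.1 (x - p.2))‖ₑ ∂mu2 := by
    refine (enorm_integral_le_lintegral_enorm _).trans_eq (lintegral_congr fun x => ?_)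
    rw [← ofReal_norm, ← ofReal_norm, ← ofReal_norm, norm_mul, norm_mul, norm_mul, norm_expI,
      norm_expJ, one_mul, mul_one, norm_star, ENNReal.ofReal_mul (norm_nonneg _)]
  rw [stockwell, enorm_smul, mul_pow, Real.enorm_of_nonneg (Real.sqrt_nonneg _),
    ← ENNReal.ofReal_pow (Real.sqrt_nonneg _), Real.sq_sqrt (abs_nonneg _)]
  calc _ ≤ ENNReal.ofReal |detA p.1| * ((∫⁻ x, ‖f x‖ₑ ^ 2 ∂mu2) *
        ∫⁻ x, ‖φ (mulA p.1 (x - p.2))‖ₑ ^ 2 ∂mu2) := by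
        gcongr
        exact (pow_le_pow_left₀ (zero_le) hint 2).trans
          (lintegral_enorm_mul_sq_le hf.1 (memLp_mu2_iff.2 hφ').1)
    _ = _ := by
        -- The Jacobian |det A_ξ|⁻¹ cancels the squared normalization |det A_ξ|.
        rw [lintegral_mu2 fun x => ‖φ (mulA p.1 (x - p.2))‖ₑ ^ 2,
          lintegral_comp_mulA_sub hp p.2 (fun y => ‖φ y‖ₑ ^ 2), lintegral_mu2 fun x => ‖φ x‖ₑ ^ 2]
        have : ENNReal.ofReal |detA p.1| * ENNReal.ofReal |detA p.1|⁻¹ = 1 := by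
          rw [← ENNReal.ofReal_mul hpos.le, mul_inv_cancel₀ hpos.ne', ENNReal.ofReal_one]
        rw [mul_comm (∫⁻ x, ‖f x‖ₑ ^ 2 ∂mu2), mul_left_comm (ENNReal.ofReal (2 * Real.pi)⁻¹),
          mul_assoc, ← mul_assoc, this, one_mul, mul_comm]

end QStockwell

/-! ### The Donoho–Stark inequality -/

theorem mainTheorem5 (φ : ℝ × ℝ → ℍ[ℝ]) (hφ : QStockwell.IsAdmissible φ)
    (hconv : QStockwell.ConvCondition φ)
    (f : ℝ × ℝ → ℍ[ℝ]) (hf : MemLp f 2 QStockwell.mu2) (hf0 : ¬ f =ᵐ[QStockwell.mu2] 0)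
    (E : Set ((ℝ × ℝ) × (ℝ × ℝ))) (hE : NullMeasurableSet E QStockwell.mu4)
    (α : ℝ) (hα : 0 ≤ α)
    (hconc : QStockwell.IsConcentrated (QStockwell.stockwell φ f) α E) :
    ENNReal.ofReal ((1 - α ^ 2) * QStockwell.admConst φ /
        (eLpNorm φ 2 QStockwell.mu2).toReal ^ 2) ≤ QStockwell.mu4 E := by
  set S := QStockwell.stockwell φ f
  set μ := QStockwell.mu4
  have hC := hφ.pos
  set C := QStockwell.admConst φ
  have hplan := QStockwell.lintegral_stockwell hφ hconv hf
  have hbound := QStockwell.enorm_stockwell_sq_le hφ.memLp_two hf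
  rw [← QStockwell.eLpNorm_two_sq f] at hplan hbound
  rw [← QStockwell.eLpNorm_two_sq φ] at hbound
  rcases eq_or_ne (μ E) ∞ with htop | htop
  · rw [htop]
    exact le_top
  set a := (eLpNorm f 2 QStockwell.mu2).toReal with ha
  set b := (eLpNorm φ 2 QStockwell.mu2).toReal with hb
  have hfa : eLpNorm f 2 QStockwell.mu2 = ENNReal.ofReal a := (ENNReal.ofReal_toReal hf.2.ne).symm
  have hφb : eLpNorm φ 2 QStockwell.mu2 = ENNReal.ofReal b :=
    (ENNReal.ofReal_toReal hφ.memLp_two.2.ne).symm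
  have ha0 : 0 < a := ENNReal.toReal_pos
    (fun h => hf0 ((eLpNorm_eq_zero_iff hf.1 (by norm_num)).1 h)) hf.2.ne
  have hb0 : 0 < b := ENNReal.toReal_pos
    (fun h => hφ.ne_zero ((eLpNorm_eq_zero_iff hφ.memLp_two.1 (by norm_num)).1 h))
    hφ.memLp_two.2.ne
  set m := (μ E).toReal with hm
  have hEm : μ E = ENNReal.ofReal m := (ENNReal.ofReal_toReal htop).symm
  have hm0 : 0 ≤ m := ENNReal.toReal_nonneg
  have hsq : ∫⁻ p in Eᶜ, ‖S p‖ₑ ^ 2 ∂μ ≤ ENNReal.ofReal α ^ 2 * ∫⁻ p, ‖S p‖ₑ ^ 2 ∂μ := by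
    have := pow_le_pow_left₀ (zero_le) hconc 2
    rwa [mul_pow, QStockwell.eLpNorm_two_sq, QStockwell.eLpNorm_two_sq] at this
  have hin : ∫⁻ p in E, ‖S p‖ₑ ^ 2 ∂μ ≤
      ENNReal.ofReal a ^ 2 * ENNReal.ofReal b ^ 2 * ENNReal.ofReal m := by
    rw [← hEm, ← hfa, ← hφb, ← setLIntegral_const]
    exact lintegral_mono hbound
  have hsum : ∫⁻ p, ‖S p‖ₑ ^ 2 ∂μ ≤
      ∫⁻ p in E, ‖S p‖ₑ ^ 2 ∂μ + ∫⁻ p in Eᶜ, ‖S p‖ₑ ^ 2 ∂μ := by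
    have := lintegral_union_le (μ := μ) (fun p => ‖S p‖ₑ ^ 2) E Eᶜ
    rwa [Set.union_compl_self, setLIntegral_univ] at this
  have key := hsum.trans (add_le_add hin hsq)
  rw [hplan, hfa] at key
  -- All quantities being finite, the inequality passes to ℝ, where the α² term can be subtracted.
  have hkey : C * a ^ 2 ≤ a ^ 2 * b ^ 2 * m + α ^ 2 * (C * a ^ 2) := by
    rw [← ENNReal.ofReal_le_ofReal_iff (by positivity), ENNReal.ofReal_add (by positivity)
      (by positivity)]
    simpa only [ENNReal.ofReal_mul, ENNReal.ofReal_pow, hC.le, ha0.le, hb0.le, hα, sq_nonneg,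
      mul_nonneg, ← mul_assoc] using key
  rw [hEm]
  refine ENNReal.ofReal_le_ofReal ?_
  rw [div_le_iff₀ (by positivity)]
  have ha2 : 0 < a ^ 2 := by positivity
  nlinarith
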